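/- **Setting.** There are $M$ arms; arm $m\in[M]$ generates i.i.d. samples $X_{m,1},X_{m,2},\dots$ from the Gaussian distribution on $\mathbb R^d$ with unknown mean $\mu_m$ and identity covariance, independently across arms. Write $\mu=(\mu_1,\dots,\mu_M)\in\mathbb R^{d\times M}$ and $d_{i,j}(\mu)=\|\mu_i-\mu_j\|^2$. Let $\mathcal C:\mathbb R^{d\times M}\to[K]^M$ be single-linkage clustering into $K$ clusters (start from singletons, repeatedly merge two clusters with the smallest minimum distance $d_{i,j}$ between their arms until $K$ clusters remain, output the cluster index of each arm; ties and the numbering of clusters are resolved by any fixed rule). For index vectors write $c\sim c'$ if they differ by a permutation of $[K]$. A problem instance is a $\mu\in\mathbb R^{d\times M}$ such that, with $c=\mathcal C(\mu)$ and $D_k=\{m: c_m=k\}$, one has $d_{\mathrm{INTRA}}<d_{\mathrm{INTER}}$, where $$d_{\mathrm{INTER}}=\min_{p\ne q}\ \min_{n\in D_p,\,m\in D_q} d_{m,n}(\mu),\qquad d_{\mathrm{INTRA}}=\max_{k}\ \max_{\emptyset\ne P\subsetneq D_k}\ \min_{i\in P,\,j\in D_k\setminus P} d_{i,j}(\mu)$$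 (an empty minimum is $\infty$, an empty maximum is $0$). Let $\mathrm{Alt}(\mu)=\{\lambda\in\mathbb R^{d\times M}:\mathcal C(\lambda)\nsim\mathcal C(\mu)\}$, let $\mathcal P_M$ be the probability simplex in $\mathbb R^M$, and let $$\psi(w,\mu)=\inf_{\lambda\in\mathrm{Alt}(\mu)}\frac12\sum_{m=1}^M w_m\|\lambda_m-\mu_m\|^2,\qquad T^*(\mu)^{-1}=\sup_{w\in\mathcal P_M}\psi(w,\mu)$$ (with $\inf\emptyset=\infty$ and $\infty^{-1}=0$). **Algorithm (ATBOC) at confidence level $\delta\in(0,1)$.** Let $N_m(t)$ be the number of samples of arm $m$ among the first $t$ samples and $\hat\mu_m(t)$ their empirical mean ($0$ if $N_m(t)=0$). For each $t\ge1$ let $w(t)$ be any element of $\operatorname{argmax}_{w\in\mathcal P_M}\psi(w,\hat\mu(t))$. The first arm is arbitrary. For $t\ge 1$, the arm $A_{t+1}$ is any element of $\operatorname{argmin}_{m}N_m(t)$ if $\min_m N_m(t)<\sqrt{t/M}$, and otherwise any minimizer of $\frac{N_m(t)}t-\frac1t\sum_{s=1}^t w_m(s)$ over the $m$ with $\sum_{s=1}^t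 w_m(s)\neq0$. The algorithm stops at $$\tau_\delta=\inf\Big\{t\ge1:\ t\,\psi\big(\tfrac{N(t)}t,\hat\mu(t)\big)\ \ge\ 2\log\Big(\frac{\sqrt{\prod_{m=1}^M(N_m(t)+1)^d}}{\delta}\Big)\Big\}.$$ **Theorem.** For every problem instance $\mu$, the sample complexity $\tau_\delta$ of ATBOC satisfies $$\limsup_{\delta\to0}\frac{\mathbb E_\mu[\tau_\delta]}{\log(1/\delta)}\ \le\ 2\,T^*(\mu).$$ -/

import Mathlib

open MeasureTheory ProbabilityTheory Filter Topology
open scoped ENNReal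

noncomputable section

namespace BanditClustering

variable {M K d : ℕ}

/-! ### Clusterings of the arms and the separation condition -/

/-- The distance `d_{i,j}` between two arms: the squared Euclidean distance of their means. -/
def armDist (x : Fin M → EuclideanSpace ℝ (Fin d)) (i j : Fin M) : ℝ :=
  ‖x i - x j‖ ^ 2

/-- The set `D_k` of the arms in cluster `k`. -/
def cluster (c : Fin M → Fin K) (k : Fin K) : Finset (Fin M) :=
  Finset.univ.filter fun m => c m = k

/-- The distance between the clusters `p` and `q`: the minimum of `d_{n,m}` over `n ∈ D_p` and
`m ∈ D_q`. -/
def clusterDist (x : Fin M → EuclideanSpace ℝ (Fin d)) (c : Fin M → Fin K) (p q : Fin K) :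
    ℝ≥0∞ :=
  ⨅ n ∈ cluster c p, ⨅ m ∈ cluster c q, ENNReal.ofReal (armDist x n m)

/-- The minimum inter-cluster distance (`∞` if there is only one cluster). -/
def dInter (x : Fin M → EuclideanSpace ℝ (Fin d)) (c : Fin M → Fin K) : ℝ≥0∞ :=
  ⨅ (p : Fin K) (q : Fin K) (_ : p ≠ q), clusterDist x c p q

/-- The maximum neighbour distance inside cluster `k`: the maximum, over all splittings of `D_k`
into two nonempty parts, of the minimum distance between the parts (`0` for a singleton). -/
def clusterIntra (x : Fin M → EuclideanSpace ℝ (Fin d)) (c : Fin M → Fin K) (k : Fin K) :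
    ℝ≥0∞ :=
  ⨆ (P : Finset (Fin M)) (_ : P.Nonempty ∧ P ⊂ cluster c k),
    ⨅ i ∈ P, ⨅ j ∈ cluster c k \ P, ENNReal.ofReal (armDist x i j)

/-- The maximum intra-cluster neighbour distance. -/
def dIntra (x : Fin M → EuclideanSpace ℝ (Fin d)) (c : Fin M → Fin K) : ℝ≥0∞ :=
  ⨆ k : Fin K, clusterIntra x c k

/-- The separation condition on a clustering problem `(x, c)`. -/
def Separated (x : Fin M → EuclideanSpace ℝ (Fin d)) (c : Fin M → Fin K) : Prop :=
  dIntra x c < dInter x c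

/-- Two cluster index vectors are equivalent if they differ by a permutation of the labels. -/
def SameClustering (c c' : Fin M → Fin K) : Prop :=
  ∃ σ : Equiv.Perm (Fin K), c = σ ∘ c'

/-! ### Single linkage clustering -/

/-- The labellings of the arms that single linkage clustering can pass through. It starts from
singletons. A step picks two arms `i`, `j` with different labels that are at the smallest distance
among all such pairs (so that their clusters form a pair of clusters with the smallest minimum
distance), and merges the clusters of `i` and `j`. Ties may be broken in any way. -/
inductive SlinkReachable (x : Fin M → EuclideanSpace ℝ (Fin d)) : (Fin M → Fin M) → Prop
  | init : SlinkReachable x id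
  | merge (l : Fin M → Fin M) (i j : Fin M) (hl : SlinkReachable x l) (hij : l i ≠ l j)
      (hmin : ∀ i' j', l i' ≠ l j' → armDist x i j ≤ armDist x i' j') :
      SlinkReachable x fun m => if l m = l j then l i else l m

/-- `c` is an output of single linkage clustering of `x` stopped at `K` clusters: all `K` indices
are used, and the clusters of `c` are the clusters of a labelling that the procedure reaches. -/
def IsSlinkOutput (x : Fin M → EuclideanSpace ℝ (Fin d)) (c : Fin M → Fin K) : Prop :=
  Function.Surjective c ∧ ∃ l, SlinkReachable x l ∧ ∀ i j, c i = c j ↔ l i = l j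

/-- `C` is an implementation of single linkage clustering into `K` clusters: it maps every
collection of mean vectors to an output of the procedure, with any rule for breaking ties and for
numbering the clusters. -/
def IsSlinkMap (C : (Fin M → EuclideanSpace ℝ (Fin d)) → Fin M → Fin K) : Prop :=
  ∀ x, IsSlinkOutput x (C x)

/-! ### The characteristic time -/

/-- The alternative space of `μ`. -/
def Alt (C : (Fin M → EuclideanSpace ℝ (Fin d)) → Fin M → Fin K)
    (μ : Fin M → EuclideanSpace ℝ (Fin d)) : Set (Fin M → EuclideanSpace ℝ (Fin d)) :=
  {ν | ¬ SameClustering (C ν) (C μ)}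

/-- The inner infimum `ψ(w, μ)`, with the value `∞` if there are no alternatives. -/
def psi (C : (Fin M → EuclideanSpace ℝ (Fin d)) → Fin M → Fin K) (w : Fin M → ℝ)
    (μ : Fin M → EuclideanSpace ℝ (Fin d)) : ℝ≥0∞ :=
  ⨅ ν ∈ Alt C μ, ENNReal.ofReal (1 / 2 * ∑ m, w m * ‖ν m - μ m‖ ^ 2)

/-- The characteristic time `T*(μ)`. -/
def charTime (C : (Fin M → EuclideanSpace ℝ (Fin d)) → Fin M → Fin K)
    (μ : Fin M → EuclideanSpace ℝ (Fin d)) : ℝ≥0∞ :=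
  (⨆ w ∈ stdSimplex ℝ (Fin M), psi C w μ)⁻¹

/-- The set `S*(μ)` of the optimal arm pull proportions. -/
def optimalWeights (C : (Fin M → EuclideanSpace ℝ (Fin d)) → Fin M → Fin K)
    (μ : Fin M → EuclideanSpace ℝ (Fin d)) : Set (Fin M → ℝ) :=
  {w | w ∈ stdSimplex ℝ (Fin M) ∧ ∀ w' ∈ stdSimplex ℝ (Fin M), psi C w' μ ≤ psi C w μ}

/-! ### The algorithm

`A t ω` is the arm that is sampled in step `t + 1`, and `X m i ω` is the sample number `i + 1` that
arm `m` generates. -/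

variable {Ω : Type*}

/-- The number `N_m(t)` of times that arm `m` is sampled in the first `t` steps. -/
def pulls (A : ℕ → Ω → Fin M) (t : ℕ) (ω : Ω) (m : Fin M) : ℕ :=
  ((Finset.range t).filter fun s => A s ω = m).card

/-- The empirical means at time `t`: arm `m` has shown its first `N_m(t)` samples (the value is `0`
as long as the arm has not been sampled). -/
def empMean (X : Fin M → ℕ → Ω → EuclideanSpace ℝ (Fin d)) (A : ℕ → Ω → Fin M) (t : ℕ) (ω : Ω)
    (m : Fin M) : EuclideanSpace ℝ (Fin d) :=
  (pulls A t ω m : ℝ)⁻¹ • ∑ i ∈ Finset.range (pulls A t ω m), X m i ω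

/-- The statistic `Z(t) = t ψ(N(t)/t, μ̂(t))`. -/
def glrStat (C : (Fin M → EuclideanSpace ℝ (Fin d)) → Fin M → Fin K)
    (X : Fin M → ℕ → Ω → EuclideanSpace ℝ (Fin d)) (A : ℕ → Ω → Fin M) (t : ℕ) (ω : Ω) : ℝ≥0∞ :=
  t * psi C (fun m => (pulls A t ω m : ℝ) / t) (empMean X A t ω)

/-- The threshold `β(δ, t)`; the argument `d` is the dimension of the samples. -/
def threshold (d : ℕ) (A : ℕ → Ω → Fin M) (δ : ℝ) (t : ℕ) (ω : Ω) : ℝ :=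
  2 * Real.log (Real.sqrt (∏ m, ((pulls A t ω m : ℝ) + 1) ^ d) / δ)

/-- The stopping time: the first `t ≥ 1` with `Z(t) ≥ β(δ, t)`, and `∞` if there is none. -/
def stopTime (C : (Fin M → EuclideanSpace ℝ (Fin d)) → Fin M → Fin K)
    (X : Fin M → ℕ → Ω → EuclideanSpace ℝ (Fin d)) (A : ℕ → Ω → Fin M) (δ : ℝ) (ω : Ω) : ℝ≥0∞ :=
  ⨅ (t : ℕ) (_ : 1 ≤ t ∧ ENNReal.ofReal (threshold d A δ t ω) ≤ glrStat C X A t ω), (t : ℝ≥0∞)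

/-- `∑_{s=1}^t w_m(s)`. -/
def cumWeight (w : ℕ → Ω → Fin M → ℝ) (t : ℕ) (ω : Ω) (m : Fin M) : ℝ :=
  ∑ s ∈ Finset.Icc 1 t, w s ω m

/-- The arms `A` and the plug-in weights `w` follow the sampling rule of the algorithm, with any
way of choosing among several minimizers or maximizers. The first arm is arbitrary, since at time
`0` all arms are equivalent and there are no weights yet. -/
structure IsATBOCRun [MeasurableSpace Ω]
    (C : (Fin M → EuclideanSpace ℝ (Fin d)) → Fin M → Fin K)
    (X : Fin M → ℕ → Ω → EuclideanSpace ℝ (Fin d)) (A : ℕ → Ω → Fin M)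
    (w : ℕ → Ω → Fin M → ℝ) : Prop where
  /-- The sampled arms are random variables. -/
  measurable_arm : ∀ t : ℕ, Measurable (A t)
  /-- `w(t)` is a maximizer of `ψ(·, μ̂(t))` over the simplex. -/
  weights : ∀ t : ℕ, 1 ≤ t → ∀ ω, w t ω ∈ optimalWeights C (empMean X A t ω)
  /-- Forced exploration: if `min_m N_m(t) < √(t/M)`, then a least sampled arm is sampled. -/
  explore : ∀ t : ℕ, 1 ≤ t → ∀ ω, (∃ m, (pulls A t ω m : ℝ) < Real.sqrt ((t : ℝ) / M)) →
    ∀ m, pulls A t ω (A t ω) ≤ pulls A t ω m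
  /-- Average tracking: otherwise, the arm minimizes `N_m(t)/t - (1/t) ∑_{s ≤ t} w_m(s)` over the
  support of `∑_{s ≤ t} w(s)`. -/
  track : ∀ t : ℕ, 1 ≤ t → ∀ ω, (∀ m, Real.sqrt ((t : ℝ) / M) ≤ (pulls A t ω m : ℝ)) →
    cumWeight w t ω (A t ω) ≠ 0 ∧
    ∀ m, cumWeight w t ω m ≠ 0 →
      (pulls A t ω (A t ω) : ℝ) / t - 1 / t * cumWeight w t ω (A t ω) ≤
        (pulls A t ω m : ℝ) / t - 1 / t * cumWeight w t ω m

end BanditClustering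

end

namespace BanditClustering

/-! ### Stability of single linkage clustering -/

/-! The instance survives small perturbations: separation is an open condition that determines the
single linkage output up to relabelling, so the set of alternatives is locally constant at `μ`
(`eventually_alt_eq`). Consequently weights that are optimal for a nearby estimate are nearly
optimal for `μ` (`exists_evidenceGE_of_optimalWeights`).

Forced exploration drives every count to infinity, so from some time on all estimates are close to
`μ`. Tracking keeps the counts within order `√t` of the accumulated weights. Since evidence is
linear in the weights, `Z(t)` eventually exceeds `c t` for every rate `c` below `1/T*`
(`exists_le_glrStat`). The threshold is `2 log(1/δ)` plus a term of order `log t`, and this factor 2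
is the one in the theorem: stopping occurs by `2 log(1/δ)/c` plus a random delay free of `δ`
(`exists_stopTime_le`).

The delay is quadratic in the last sample size at which some sample mean is inaccurate. Gaussian
tails make it integrable (`exists_lintegral_lt_top`), so it vanishes after division by `log(1/δ)`;
then `c` tends to `1/T*`. -/

/-- Distances between different clusters exceed `θ`, while every splitting of a cluster is bridged
by a pair of arms at distance less than `θ`. -/
def SeparatedAt {M K d : ℕ} (θ : ℝ) (x : Fin M → EuclideanSpace ℝ (Fin d)) (c : Fin M → Fin K) :
    Prop :=
  (∀ i j, c i ≠ c j → θ < armDist x i j) ∧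
    ∀ k, ∀ Q : Finset (Fin M), Q.Nonempty → Q ⊂ cluster c k →
      ∃ i ∈ Q, ∃ j ∈ cluster c k \ Q, armDist x i j < θ

variable {M K d : ℕ}

/-- Any finite threshold strictly between the intra and inter distances works; it replaces
extended-real extrema by strict real inequalities. -/
theorem Separated.exists_separatedAt {x : Fin M → EuclideanSpace ℝ (Fin d)} {c : Fin M → Fin K}
    (h : Separated x c) : ∃ θ, SeparatedAt θ x c := by
  obtain ⟨θ, h1, h2⟩ := ENNReal.lt_iff_exists_nnreal_btwn.1 h
  refine ⟨θ, fun i j hij => ?_, fun k Q hQ hQk => ?_⟩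
  · have h3 : dInter x c ≤ ENNReal.ofReal (armDist x i j) := by
      refine (iInf₂_le_of_le (c i) (c j) (iInf_le_of_le hij ?_))
      exact iInf₂_le_of_le i (by simp [cluster]) (iInf₂_le j (by simp [cluster]))
    have h4 := h2.trans_le h3
    rw [← ENNReal.ofReal_coe_nnreal] at h4
    exact (ENNReal.ofReal_lt_ofReal_iff_of_nonneg θ.2).1 h4
  · have h3 : ⨅ i ∈ Q, ⨅ j ∈ cluster c k \ Q, ENNReal.ofReal (armDist x i j) < (θ : ℝ≥0∞) := by
      refine lt_of_le_of_lt ?_ h1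
      refine le_trans ?_ (le_iSup _ k)
      exact le_iSup₂_of_le Q ⟨hQ, hQk⟩ le_rfl
    simp only [iInf_lt_iff] at h3
    obtain ⟨i, hi, j, hj, hij⟩ := h3
    refine ⟨i, hi, j, hj, ?_⟩
    rw [← ENNReal.ofReal_coe_nnreal] at hij
    exact (ENNReal.ofReal_lt_ofReal_iff'.1 hij).1

/-- Only finitely many strict inequalities between continuous functions of the means are involved,
and the bridging pairs can be kept. -/
theorem SeparatedAt.eventually {θ : ℝ} {x : Fin M → EuclideanSpace ℝ (Fin d)} {c : Fin M → Fin K}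
    (h : SeparatedAt θ x c) : ∀ᶠ y in 𝓝 x, SeparatedAt θ y c := by
  have hc : ∀ i j, Continuous fun y : Fin M → EuclideanSpace ℝ (Fin d) => armDist y i j := by
    intro i j
    unfold armDist
    fun_prop
  have h1 : ∀ᶠ y in 𝓝 x, ∀ i j, c i ≠ c j → θ < armDist y i j := by
    refine eventually_all.2 fun i => eventually_all.2 fun j => eventually_imp_distrib_left.2 ?_
    exact fun hij => (hc i j).continuousAt.eventually_const_lt (h.1 i j hij)
  have h2 : ∀ᶠ y in 𝓝 x, ∀ i j, armDist x i j < θ → armDist y i j < θ := by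
    refine eventually_all.2 fun i => eventually_all.2 fun j => eventually_imp_distrib_left.2 ?_
    exact fun hij => (hc i j).continuousAt.eventually_lt_const hij
  filter_upwards [h1, h2] with y hy1 hy2
  refine ⟨hy1, fun k Q hQ hQk => ?_⟩
  obtain ⟨i, hi, j, hj, hij⟩ := h.2 k Q hQ hQk
  exact ⟨i, hi, j, hj, hy2 i j hij⟩

/-- On a separated instance, single linkage only passes through labellings that are comparable with
the true clustering. -/
theorem SeparatedAt.comparable {θ : ℝ} {x : Fin M → EuclideanSpace ℝ (Fin d)} {c : Fin M → Fin K}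
    (h : SeparatedAt θ x c) {l : Fin M → Fin M} (hl : SlinkReachable x l) :
    (∀ i j, l i = l j → c i = c j) ∨ ∀ i j, c i = c j → l i = l j := by
  induction hl with
  | init => exact Or.inl fun i j hij => congrArg c hij
  | merge l i j _ hij hmin ih =>
    have coarser : (∀ a b, c a = c b → l a = l b) →
        ∀ a b, c a = c b → (if l a = l j then l i else l a) = if l b = l j then l i else l b :=
      fun hcl a b hab => by rw [hcl a b hab]
    rcases ih with ih | ih
    · by_cases hcl : ∀ a b, c a = c b → l a = l b
      · exact Or.inr (coarser hcl)
      · push Not at hcl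
        obtain ⟨a, b, hab, hlab⟩ := hcl
        -- The current cluster of `a` is a proper part of a true cluster, so some pair with
        -- different labels is closer than `θ`. The minimizing pair `i`, `j` is then also closer
        -- than `θ` and lies in one true cluster: the merge preserves refinement.
        have hsub : (Finset.univ.filter fun m => l m = l a) ⊂ cluster c (c a) := by
          refine ⟨fun m hm => ?_, fun hsub => hlab ?_⟩
          · simp only [Finset.mem_filter, Finset.mem_univ, true_and, cluster] at hm ⊢
            exact ih m a hm
          · have := hsub (show b ∈ cluster c (c a) by simp [cluster, hab])
            simpa using (Finset.mem_filter.1 this).2.symm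
        obtain ⟨p, hp, q, hq, hpq⟩ := h.2 (c a) _ ⟨a, by simp⟩ hsub
        have hne : l p ≠ l q := by
          simp only [Finset.mem_filter, Finset.mem_univ, true_and, Finset.mem_sdiff] at hp hq
          rw [hp]
          exact fun e => hq.2 e.symm
        have hcij : c i = c j := by
          by_contra hc
          exact absurd (h.1 i j hc) (not_lt.2 ((hmin p q hne).trans hpq.le))
        refine Or.inl fun u v huv => ?_
        dsimp only at huv
        split_ifs at huv with hu hv hv
        · exact ih u v (hu.trans hv.symm)
        · exact (ih u j hu).trans (hcij.symm.trans (ih i v huv))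
        · exact (ih u i huv).trans (hcij.trans (ih v j hv).symm)
        · exact ih u v huv
    · exact Or.inr (coarser ih)

theorem SameClustering.symm {c c' : Fin M → Fin K} (h : SameClustering c c') :
    SameClustering c' c := by
  obtain ⟨σ, rfl⟩ := h
  exact ⟨σ⁻¹, by ext; simp⟩

theorem SameClustering.trans {c c' c'' : Fin M → Fin K} (h : SameClustering c c')
    (h' : SameClustering c' c'') : SameClustering c c'' := by
  obtain ⟨σ, rfl⟩ := h
  obtain ⟨τ, rfl⟩ := h'
  exact ⟨σ * τ, by ext; simp⟩

/-- Refinement makes `c'` factor through `c`. The factor is a surjection of the finite set `Fin K`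
onto itself, hence a permutation. -/
theorem sameClustering_of_refines {c c' : Fin M → Fin K} (hc : Function.Surjective c)
    (hc' : Function.Surjective c') (h : ∀ i j, c i = c j → c' i = c' j) : SameClustering c' c := by
  choose g hg using hc
  have hf : ∀ i, c' (g (c i)) = c' i := fun i => h _ _ (hg _)
  have hs : Function.Surjective fun k => c' (g k) := fun k => by
    obtain ⟨i, rfl⟩ := hc' k
    exact ⟨c i, hf i⟩
  exact ⟨Equiv.ofBijective _ (Finite.surjective_iff_bijective.1 hs), by ext i; simp [hf]⟩

theorem SeparatedAt.sameClustering {θ : ℝ} {x : Fin M → EuclideanSpace ℝ (Fin d)}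
    {c c' : Fin M → Fin K} (h : SeparatedAt θ x c) (hc : Function.Surjective c)
    (hc' : IsSlinkOutput x c') : SameClustering c' c := by
  obtain ⟨hs, l, hl, hlc⟩ := hc'
  rcases h.comparable hl with h1 | h1
  · exact (sameClustering_of_refines hs hc fun i j hij => h1 i j ((hlc i j).1 hij)).symm
  · exact sameClustering_of_refines hc hs fun i j hij => (hlc i j).2 (h1 i j hij)

/-- The alternative space is locally constant at a problem instance. -/
theorem eventually_alt_eq {C : (Fin M → EuclideanSpace ℝ (Fin d)) → Fin M → Fin K}
    (hC : IsSlinkMap C) {μ : Fin M → EuclideanSpace ℝ (Fin d)} (hμ : Separated μ (C μ)) :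
    ∀ᶠ x in 𝓝 μ, Alt C x = Alt C μ := by
  obtain ⟨θ, hθ⟩ := hμ.exists_separatedAt
  filter_upwards [hθ.eventually] with x hx
  have h := hx.sameClustering (hC μ).1 (hC x)
  ext ν
  exact not_congr ⟨fun h' => h'.trans h, fun h' => h'.trans h.symm⟩

end BanditClustering

namespace BanditClustering

/-! ### Continuity of the inner infimum -/

variable {M K d : ℕ}

/-- Every `ν ∈ S` is at weighted half squared distance at least `c` from `x`. -/
def EvidenceGE (S : Set (Fin M → EuclideanSpace ℝ (Fin d))) (w : Fin M → ℝ)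
    (x : Fin M → EuclideanSpace ℝ (Fin d)) (c : ℝ) : Prop :=
  ∀ ν ∈ S, c ≤ 1 / 2 * ∑ m, w m * ‖ν m - x m‖ ^ 2

/-- Moves lower bounds on `psi` into real arithmetic. Nonnegative weights ensure that
`ENNReal.ofReal` does not truncate the evidence. -/
theorem le_psi_iff {C : (Fin M → EuclideanSpace ℝ (Fin d)) → Fin M → Fin K} {w : Fin M → ℝ}
    (hw : ∀ m, 0 ≤ w m) {x : Fin M → EuclideanSpace ℝ (Fin d)} {c : ℝ} :
    ENNReal.ofReal c ≤ psi C w x ↔ EvidenceGE (Alt C x) w x c := by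
  unfold psi EvidenceGE
  rw [le_iInf₂_iff]
  refine forall₂_congr fun ν _ => ENNReal.ofReal_le_ofReal_iff ?_
  exact mul_nonneg (by norm_num) (Finset.sum_nonneg fun m _ => mul_nonneg (hw m) (sq_nonneg _))

/-- The evidence depends continuously on the centre, uniformly over the weights. -/
theorem EvidenceGE.exists_perturb {c c' : ℝ} (hc : c' < c) :
    ∃ ξ > 0, ∀ (S : Set (Fin M → EuclideanSpace ℝ (Fin d))), ∀ w ∈ stdSimplex ℝ (Fin M),
      ∀ x y : Fin M → EuclideanSpace ℝ (Fin d), (∀ m, ‖x m - y m‖ ≤ ξ) →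
        EvidenceGE S w x c → EvidenceGE S w y c' := by
  -- Alternatives may be arbitrarily far away, so the loss is split by Young's inequality `(a + ξ)²
  -- ≤ (1 + γ) a² + (1 + γ⁻¹) ξ²` into a relative part and a part bounded uniformly in `ν`.
  obtain ⟨γ, hγ, hγc⟩ : ∃ γ : ℝ, 0 < γ ∧ (1 + γ) * c' < c := by
    have h : Tendsto (fun γ : ℝ => (1 + γ) * c') (𝓝[>] 0) (𝓝 ((1 + 0) * c')) :=
      ((continuous_const.add continuous_id).mul continuous_const).continuousAt.tendsto.mono_left
        nhdsWithin_le_nhds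
    have h2 := h.eventually_lt_const (show (1 + 0) * c' < c by simpa using hc)
    obtain ⟨γ, h3, h4⟩ := (h2.and self_mem_nhdsWithin).exists
    exact ⟨γ, h4, h3⟩
  obtain ⟨ξ, hξ, hξc⟩ : ∃ ξ : ℝ, 0 < ξ ∧ (1 + γ⁻¹) * ξ ^ 2 / 2 < c - (1 + γ) * c' := by
    have h : Tendsto (fun ξ : ℝ => (1 + γ⁻¹) * ξ ^ 2 / 2) (𝓝[>] 0)
        (𝓝 ((1 + γ⁻¹) * 0 ^ 2 / 2)) :=
      (by fun_prop : Continuous fun ξ : ℝ => (1 + γ⁻¹) * ξ ^ 2 / 2).continuousAt.tendsto.mono_left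
        nhdsWithin_le_nhds
    have h2 := h.eventually_lt_const (show _ < c - (1 + γ) * c' by simpa using hγc)
    obtain ⟨ξ, h3, h4⟩ := (h2.and self_mem_nhdsWithin).exists
    exact ⟨ξ, h4, h3⟩
  refine ⟨ξ, hξ, fun S w hw x y hxy h ν hν => ?_⟩
  have hpt : ∀ m, w m * ‖ν m - x m‖ ^ 2 ≤
      (1 + γ) * (w m * ‖ν m - y m‖ ^ 2) + w m * ((1 + γ⁻¹) * ξ ^ 2) := by
    intro m
    have h1 : ‖ν m - x m‖ ≤ ‖ν m - y m‖ + ξ := by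
      calc ‖ν m - x m‖ = ‖(ν m - y m) - (x m - y m)‖ := by congr 1; abel
        _ ≤ ‖ν m - y m‖ + ‖x m - y m‖ := norm_sub_le _ _
        _ ≤ _ := by gcongr; exact hxy m
    have h2 : ‖ν m - x m‖ ^ 2 ≤ (1 + γ) * ‖ν m - y m‖ ^ 2 + (1 + γ⁻¹) * ξ ^ 2 := by
      refine (pow_le_pow_left₀ (norm_nonneg _) h1 2).trans ?_
      have h3 : (1 + γ) * ‖ν m - y m‖ ^ 2 + (1 + γ⁻¹) * ξ ^ 2 - (‖ν m - y m‖ + ξ) ^ 2 =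
          γ⁻¹ * (γ * ‖ν m - y m‖ - ξ) ^ 2 := by
        field_simp
        ring
      have h4 : 0 ≤ γ⁻¹ * (γ * ‖ν m - y m‖ - ξ) ^ 2 := by positivity
      linarith
    nlinarith [mul_le_mul_of_nonneg_left h2 (hw.1 m)]
  have hsum := Finset.sum_le_sum fun m (_ : m ∈ Finset.univ) => hpt m
  rw [Finset.sum_add_distrib, ← Finset.mul_sum, ← Finset.sum_mul, hw.2] at hsum
  have h5 := h ν hν
  have h6 : (1 + γ) * c' < (1 + γ) * (1 / 2 * ∑ m, w m * ‖ν m - y m‖ ^ 2) := by linarith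
  exact (lt_of_mul_lt_mul_left h6 (by positivity)).le

/-- Weights near a weight vector with much evidence have much evidence. -/
theorem EvidenceGE.exists_weights_perturb (S : Set (Fin M → EuclideanSpace ℝ (Fin d)))
    (x : Fin M → EuclideanSpace ℝ (Fin d)) {c c' : ℝ} (hc : c' < c) :
    ∃ η > 0, ∀ w ∈ stdSimplex ℝ (Fin M), ∀ w' : Fin M → ℝ, (∀ m, 0 ≤ w' m) →
      (∀ m, w m - η ≤ w' m) → EvidenceGE S w x c → EvidenceGE S w' x c' := by
  -- Compactness of the simplex gives a limit `w0` of counterexamples, still with evidence `c`.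
  -- Distances are unbounded over `S`, so the comparison is multiplicative: eventually `r * w0 ≤ w'`
  -- coordinatewise with `r < 1`, which is free where `w0` vanishes.
  by_contra! hcon
  choose! w hw w' hw' hww' hE hE' using fun n : ℕ => hcon (1 / ((n : ℝ) + 1)) (by positivity)
  obtain ⟨w0, hw0, φ, hφ, hlim⟩ := (isCompact_stdSimplex ℝ (Fin M)).tendsto_subseq hw
  have hlim' : ∀ m, Tendsto (fun n => w (φ n) m) atTop (𝓝 (w0 m)) := fun m =>
    (tendsto_pi_nhds.1 hlim) m
  have hE0 : EvidenceGE S w0 x c := fun ν hν => by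
    refine ge_of_tendsto' (f := fun n => 1 / 2 * ∑ m, w (φ n) m * ‖ν m - x m‖ ^ 2) (x := atTop)
      ?_ fun n => hE (φ n) ν hν
    exact (tendsto_finsetSum _ fun m _ => (hlim' m).mul_const _).const_mul _
  obtain ⟨r, hr0, hr1, hrc⟩ : ∃ r : ℝ, 0 < r ∧ r < 1 ∧ c' < r * c := by
    have h : Tendsto (fun r : ℝ => r * c) (𝓝[<] 1) (𝓝 (1 * c)) :=
      (continuous_id.mul continuous_const).continuousAt.tendsto.mono_left nhdsWithin_le_nhds
    have h2 := h.eventually_const_lt (show c' < 1 * c by simpa using hc)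
    have h3 : ∀ᶠ r : ℝ in 𝓝[<] 1, 0 < r :=
      nhdsWithin_le_nhds (lt_mem_nhds one_pos)
    obtain ⟨r, h4, h5, h6⟩ := (h2.and (h3.and self_mem_nhdsWithin)).exists
    exact ⟨r, h5, h6, h4⟩
  have hev : ∀ᶠ n in atTop, ∀ m, r * w0 m ≤ w' (φ n) m := by
    refine eventually_all.2 fun m => ?_
    rcases (hw0.1 m).eq_or_lt with h0 | h0
    · exact Eventually.of_forall fun n => by rw [← h0, mul_zero]; exact hw' _ m
    · have h1 : Tendsto (fun n => w (φ n) m - 1 / (((φ n : ℕ) : ℝ) + 1)) atTop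
          (𝓝 (w0 m - 0)) :=
        (hlim' m).sub (tendsto_one_div_add_atTop_nhds_zero_nat.comp hφ.tendsto_atTop)
      have h2 : r * w0 m < w0 m - 0 := by nlinarith
      filter_upwards [h1.eventually_const_lt h2] with n hn
      exact hn.le.trans (hww' _ m)
  obtain ⟨n, hn⟩ := hev.exists
  refine hE' (φ n) fun ν hν => ?_
  have h1 := mul_le_mul_of_nonneg_left (hE0 ν hν) hr0.le
  have h2 : ∑ m, r * w0 m * ‖ν m - x m‖ ^ 2 ≤ ∑ m, w' (φ n) m * ‖ν m - x m‖ ^ 2 :=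
    Finset.sum_le_sum fun m _ => mul_le_mul_of_nonneg_right (hn m) (sq_nonneg _)
  simp only [mul_assoc] at h2
  rw [← Finset.mul_sum] at h2
  linarith

/-- Optimal weights of nearby instances are nearly optimal. -/
theorem exists_evidenceGE_of_optimalWeights
    {C : (Fin M → EuclideanSpace ℝ (Fin d)) → Fin M → Fin K} (hC : IsSlinkMap C)
    {μ : Fin M → EuclideanSpace ℝ (Fin d)} (hμ : Separated μ (C μ)) {c c' : ℝ} (hc : c' < c)
    (hsup : ENNReal.ofReal c < ⨆ w ∈ stdSimplex ℝ (Fin M), psi C w μ) :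
    ∃ ξ > 0, ∀ x : Fin M → EuclideanSpace ℝ (Fin d), (∀ m, ‖x m - μ m‖ ≤ ξ) →
      Alt C x = Alt C μ ∧ ∀ w ∈ optimalWeights C x, EvidenceGE (Alt C μ) w μ c' := by
  obtain ⟨w₀, hw₀, hlt⟩ : ∃ w ∈ stdSimplex ℝ (Fin M), ENNReal.ofReal c < psi C w μ := by
    simpa only [lt_iSup_iff, exists_prop] using hsup
  have hE := (le_psi_iff hw₀.1).1 hlt.le
  -- The intermediate value `e` allows two changes of centre: `w₀` is moved from `μ` to `x`,
  -- optimality at `x` passes the bound to `w`, and `w` is moved back to `μ`.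
  obtain ⟨e, he1, he2⟩ := exists_between hc
  obtain ⟨ξ₁, hξ₁, h1⟩ := EvidenceGE.exists_perturb (M := M) (d := d) he2
  obtain ⟨ξ₂, hξ₂, h2⟩ := EvidenceGE.exists_perturb (M := M) (d := d) he1
  obtain ⟨ξ₃, hξ₃, h3⟩ := Metric.eventually_nhds_iff.1 (eventually_alt_eq hC hμ)
  refine ⟨min (min ξ₁ ξ₂) (ξ₃ / 2), by positivity, fun x hx => ?_⟩
  have hA : Alt C x = Alt C μ := h3 <| by
    refine lt_of_le_of_lt ((dist_pi_le_iff (by positivity)).2 fun m => ?_) (half_lt_self hξ₃)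
    rw [dist_eq_norm]
    exact (hx m).trans (min_le_right _ _)
  refine ⟨hA, fun w hw => ?_⟩
  have h4 : EvidenceGE (Alt C x) w₀ x e := hA ▸ h1 _ _ hw₀ μ x (fun m => by
    rw [norm_sub_rev]
    exact (hx m).trans ((min_le_left _ _).trans (min_le_left _ _))) hE
  have h5 := (le_psi_iff hw.1.1).1 (((le_psi_iff hw₀.1).2 h4).trans (hw.2 _ hw₀))
  exact h2 _ _ hw.1 x μ (fun m => (hx m).trans ((min_le_left _ _).trans (min_le_right _ _)))
    (hA ▸ h5)

end BanditClustering

namespace BanditClustering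

/-! ### The sampling rule -/

variable {M K d : ℕ} {Ω : Type*}

theorem pulls_succ (A : ℕ → Ω → Fin M) (t : ℕ) (ω : Ω) (m : Fin M) :
    pulls A (t + 1) ω m = pulls A t ω m + if A t ω = m then 1 else 0 := by
  unfold pulls
  rw [Finset.range_add_one, Finset.filter_insert]
  split_ifs <;> simp

theorem pulls_mono (A : ℕ → Ω → Fin M) (ω : Ω) (m : Fin M) :
    Monotone fun t => pulls A t ω m :=
  monotone_nat_of_le_succ fun t => by simp [pulls_succ]

theorem pulls_le (A : ℕ → Ω → Fin M) (t : ℕ) (ω : Ω) (m : Fin M) : pulls A t ω m ≤ t :=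
  (Finset.card_filter_le _ _).trans (by simp)

theorem sum_pulls (A : ℕ → Ω → Fin M) (t : ℕ) (ω : Ω) : ∑ m, pulls A t ω m = t := by
  induction t with
  | zero => simp [pulls]
  | succ t ih => simp [pulls_succ, Finset.sum_add_distrib, ih]

theorem cumWeight_succ (w : ℕ → Ω → Fin M → ℝ) (t : ℕ) (ω : Ω) (m : Fin M) :
    cumWeight w (t + 1) ω m = cumWeight w t ω m + w (t + 1) ω m :=
  Finset.sum_Icc_succ_top (by omega) _

variable [MeasurableSpace Ω] {C : (Fin M → EuclideanSpace ℝ (Fin d)) → Fin M → Fin K}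
  {X : Fin M → ℕ → Ω → EuclideanSpace ℝ (Fin d)} {A : ℕ → Ω → Fin M} {w : ℕ → Ω → Fin M → ℝ}

theorem IsATBOCRun.weights_mem (h : IsATBOCRun C X A w) {t : ℕ} (ht : 1 ≤ t) (ω : Ω) :
    w t ω ∈ stdSimplex ℝ (Fin M) :=
  (h.weights t ht ω).1

theorem IsATBOCRun.cumWeight_nonneg (h : IsATBOCRun C X A w) (t : ℕ) (ω : Ω) (m : Fin M) :
    0 ≤ cumWeight w t ω m :=
  Finset.sum_nonneg fun _ hs => (h.weights_mem (Finset.mem_Icc.1 hs).1 ω).1 m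

theorem IsATBOCRun.sum_cumWeight (h : IsATBOCRun C X A w) (t : ℕ) (ω : Ω) :
    ∑ m, cumWeight w t ω m = t := by
  unfold cumWeight
  rw [Finset.sum_comm, Finset.sum_congr rfl fun s hs =>
    (h.weights_mem (Finset.mem_Icc.1 hs).1 ω).2]
  simp

/-- Forced exploration makes all sample counts grow at least like the square root of the time. -/
theorem IsATBOCRun.le_pulls (h : IsATBOCRun C X A w) (ω : Ω) {k t : ℕ} (hk : 1 ≤ k)
    (ht : M * k ^ 2 + M * k ≤ t) (m : Fin M) : k ≤ pulls A t ω m := by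
  have hM : 0 < M := m.pos
  -- The potential is the total deficit below `k`, at most `M * k`. After time `M * k ^ 2` one has
  -- `k ≤ √(u/M)`, so any deficit forces exploration of a least sampled arm, and each such step
  -- lowers the potential.
  have key : ∀ s, ∑ m, (k - pulls A (M * k ^ 2 + s) ω m) + s ≤ M * k ∨
      ∑ m, (k - pulls A (M * k ^ 2 + s) ω m) = 0 := by
    intro s
    induction s with
    | zero =>
      left
      simpa using Finset.sum_le_card_nsmul Finset.univ
        (fun m => k - pulls A (M * k ^ 2) ω m) k fun m _ => Nat.sub_le _ _
    | succ s ih =>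
      set u := M * k ^ 2 + s with hu
      have hle : ∀ m, k - pulls A (u + 1) ω m ≤ k - pulls A u ω m := fun m =>
        Nat.sub_le_sub_left (pulls_mono A ω m (Nat.le_succ u)) k
      rw [show M * k ^ 2 + (s + 1) = u + 1 from rfl]
      by_cases h0 : ∑ m, (k - pulls A u ω m) = 0
      · right
        exact Nat.eq_zero_of_le_zero (h0 ▸ Finset.sum_le_sum fun m _ => hle m)
      · left
        have h1 := ih.resolve_right h0
        obtain ⟨a, -, ha⟩ := Finset.exists_ne_zero_of_sum_ne_zero h0
        have hak : pulls A u ω a < k := by omega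
        have hu1 : 1 ≤ u := le_trans (Nat.mul_pos hM (pow_pos hk 2)) (Nat.le_add_right _ s)
        have hsqrt : (k : ℝ) ≤ Real.sqrt ((u : ℝ) / M) := by
          refine Real.le_sqrt_of_sq_le ?_
          rw [le_div_iff₀ (by exact_mod_cast hM), mul_comm]
          exact_mod_cast Nat.le_add_right _ s
        have hmin := h.explore u hu1 ω ⟨a, lt_of_lt_of_le (by exact_mod_cast hak) hsqrt⟩ a
        have hlt : ∑ m, (k - pulls A (u + 1) ω m) < ∑ m, (k - pulls A u ω m) := by
          refine Finset.sum_lt_sum (fun m _ => hle m) ⟨A u ω, Finset.mem_univ _, ?_⟩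
          rw [pulls_succ, if_pos rfl]
          omega
        omega
  obtain ⟨s, rfl⟩ := Nat.exists_eq_add_of_le ((Nat.le_add_right _ _).trans ht)
  have h0 : ∑ m, (k - pulls A (M * k ^ 2 + s) ω m) = 0 := by
    rcases key s with h1 | h1 <;> omega
  have := (Finset.sum_eq_zero_iff.1 h0) m (Finset.mem_univ m)
  omega

/-- In a tracking step the sampled arm has not been sampled too often. -/
theorem IsATBOCRun.pulls_le_cumWeight_of_track (h : IsATBOCRun C X A w) (ω : Ω) {t : ℕ}
    (ht : 1 ≤ t) (htr : ∀ m, Real.sqrt ((t : ℝ) / M) ≤ (pulls A t ω m : ℝ)) :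
    (pulls A t ω (A t ω) : ℝ) ≤ cumWeight w t ω (A t ω) := by
  by_contra! hlt
  have ht0 : (0 : ℝ) < t := by exact_mod_cast ht
  -- If the minimal difference were positive, all differences would be nonnegative (outside the
  -- support the difference is just the count), contradicting that they sum to zero.
  have hnn : ∀ m, 0 ≤ (pulls A t ω m : ℝ) - cumWeight w t ω m := by
    intro m
    by_cases hm : cumWeight w t ω m = 0
    · rw [hm, sub_zero]
      positivity
    · have h1 := (h.track t ht ω htr).2 m hm
      have h2 : ((pulls A t ω (A t ω) : ℝ) - cumWeight w t ω (A t ω)) / t ≤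
          ((pulls A t ω m : ℝ) - cumWeight w t ω m) / t := by
        convert h1 using 1 <;> ring
      have h3 := (div_le_div_iff_of_pos_right ht0).1 h2
      linarith
  have hpos : 0 < ∑ m, ((pulls A t ω m : ℝ) - cumWeight w t ω m) :=
    Finset.sum_pos' (fun m _ => hnn m) ⟨A t ω, Finset.mem_univ _, by linarith⟩
  rw [Finset.sum_sub_distrib, h.sum_cumWeight, ← Nat.cast_sum, sum_pulls, sub_self] at hpos
  exact lt_irrefl _ hpos

/-- The bound can only be threatened when the arm is sampled. Under exploration its count was below
`√t`; under tracking it was at most its accumulated weight. The added 1 is the new sample. -/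
theorem IsATBOCRun.pulls_le_cumWeight_add (h : IsATBOCRun C X A w) (ω : Ω) (t : ℕ) (m : Fin M) :
    (pulls A t ω m : ℝ) ≤ cumWeight w t ω m + (Real.sqrt t + 1) := by
  induction t with
  | zero => simp [pulls, cumWeight]
  | succ t ih =>
    have hW := h.cumWeight_nonneg (t + 1) ω m
    have hw0 := (h.weights_mem (Nat.succ_pos t) ω).1 m
    have hsq : Real.sqrt t ≤ Real.sqrt ((t + 1 : ℕ) : ℝ) := Real.sqrt_le_sqrt (by simp)
    have hs0 := Real.sqrt_nonneg (t : ℝ)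
    rw [pulls_succ]
    split_ifs with hA
    · subst hA
      rcases Nat.eq_zero_or_pos t with rfl | ht
      · have : pulls A 0 ω (A 0 ω) = 0 := by simp [pulls]
        rw [this, show ((0 + 1 : ℕ) : ℝ) = 1 by norm_num, Real.sqrt_one]
        linarith
      · by_cases hex : ∃ m, (pulls A t ω m : ℝ) < Real.sqrt ((t : ℝ) / M)
        · obtain ⟨a, ha⟩ := hex
          have h1 : (pulls A t ω (A t ω) : ℝ) ≤ pulls A t ω a := by
            exact_mod_cast h.explore t ht ω ⟨a, ha⟩ a
          have h2 : Real.sqrt ((t : ℝ) / M) ≤ Real.sqrt t :=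
            Real.sqrt_le_sqrt (div_le_self (by positivity) (by exact_mod_cast a.pos))
          push_cast at hsq ⊢
          linarith
        · push Not at hex
          have h1 := h.pulls_le_cumWeight_of_track ω ht hex
          rw [cumWeight_succ]
          push_cast at hsq ⊢
          linarith
    · rw [cumWeight_succ, add_zero]
      linarith

/-- Average tracking keeps the sample counts close to the accumulated weights. -/
theorem IsATBOCRun.cumWeight_le_pulls_add (h : IsATBOCRun C X A w) (ω : Ω) (t : ℕ) (m : Fin M) :
    cumWeight w t ω m ≤ pulls A t ω m + M * (Real.sqrt t + 1) := by
  -- The differences cancel, so the deficit of one arm is the total excess of the others.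
  have h0 : ∑ a, ((pulls A t ω a : ℝ) - cumWeight w t ω a) = 0 := by
    rw [Finset.sum_sub_distrib, h.sum_cumWeight, ← Nat.cast_sum, sum_pulls, sub_self]
  rw [← Finset.add_sum_erase _ _ (Finset.mem_univ m)] at h0
  have h1 := Finset.sum_le_card_nsmul (Finset.univ.erase m)
    (fun a => (pulls A t ω a : ℝ) - cumWeight w t ω a) (Real.sqrt t + 1) fun a _ => by
      linarith [h.pulls_le_cumWeight_add ω t a]
  rw [nsmul_eq_mul] at h1
  have h2 : ((Finset.univ.erase m).card : ℝ) ≤ M := by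
    exact_mod_cast (Finset.card_le_univ _).trans (by simp)
  have h3 := mul_le_mul_of_nonneg_right h2 (show 0 ≤ Real.sqrt t + 1 by positivity)
  linarith

end BanditClustering

namespace BanditClustering

/-! ### The stopping rule -/

section Deterministic

variable {M K d : ℕ}

theorem threshold_le {Ω : Type*} (A : ℕ → Ω → Fin M) {δ : ℝ} (hδ : 0 < δ) (t : ℕ) (ω : Ω) :
    threshold d A δ t ω ≤ M * d * Real.log (t + 1) + 2 * Real.log (1 / δ) := by
  have hpos : ∀ m, (0 : ℝ) < (pulls A t ω m : ℝ) + 1 := fun m => by positivity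
  have hprod : 0 < ∏ m, ((pulls A t ω m : ℝ) + 1) ^ d :=
    Finset.prod_pos fun m _ => pow_pos (hpos m) d
  have h1 : Real.log (∏ m, ((pulls A t ω m : ℝ) + 1) ^ d) ≤ M * (d * Real.log (t + 1)) := by
    rw [Real.log_prod fun m _ => (pow_pos (hpos m) d).ne']
    refine (Finset.sum_le_card_nsmul _ _ (d * Real.log (t + 1)) fun m _ => ?_).trans (by simp)
    rw [Real.log_pow]
    gcongr
    exact pulls_le A t ω m
  rw [threshold, Real.log_div (Real.sqrt_pos.2 hprod).ne' hδ.ne', Real.log_sqrt hprod.le, one_div,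
    Real.log_inv]
  linarith

/-- The evidence of the accumulated weights is at least the sum of the evidences. -/
theorem evidenceGE_cumWeight {Ω : Type*} {S : Set (Fin M → EuclideanSpace ℝ (Fin d))}
    {x : Fin M → EuclideanSpace ℝ (Fin d)} {w : ℕ → Ω → Fin M → ℝ} {ω : Ω} {c : ℝ} {s t : ℕ}
    (hw : ∀ i, 1 ≤ i → ∀ m, 0 ≤ w i ω m) (hst : s ≤ t) (ht : 0 < t)
    (h : ∀ i, s < i → EvidenceGE S (w i ω) x c) :
    EvidenceGE S (fun m => cumWeight w t ω m / t) x ((t - s) / t * c) := by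
  intro ν hν
  have ht0 : (0 : ℝ) < t := by exact_mod_cast ht
  have h1 : ∑ m, cumWeight w t ω m / t * ‖ν m - x m‖ ^ 2 =
      (∑ i ∈ Finset.Icc 1 t, ∑ m, w i ω m * ‖ν m - x m‖ ^ 2) / t := by
    rw [Finset.sum_comm, Finset.sum_div]
    refine Finset.sum_congr rfl fun m _ => ?_
    rw [cumWeight, ← Finset.sum_mul]
    ring
  have h2 : ∑ i ∈ Finset.Ioc s t, ∑ m, w i ω m * ‖ν m - x m‖ ^ 2 ≤
      ∑ i ∈ Finset.Icc 1 t, ∑ m, w i ω m * ‖ν m - x m‖ ^ 2 := by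
    refine Finset.sum_le_sum_of_subset_of_nonneg (fun i hi => ?_) fun i hi _ => ?_
    · rw [Finset.mem_Ioc] at hi
      exact Finset.mem_Icc.2 ⟨by omega, hi.2⟩
    · exact Finset.sum_nonneg fun m _ =>
        mul_nonneg (hw i (Finset.mem_Icc.1 hi).1 m) (sq_nonneg _)
  have h3 := Finset.card_nsmul_le_sum (Finset.Ioc s t)
    (fun i => ∑ m, w i ω m * ‖ν m - x m‖ ^ 2) (2 * c) fun i hi => by
      linarith [h i (Finset.mem_Ioc.1 hi).1 ν hν]
  rw [nsmul_eq_mul, Nat.card_Ioc, Nat.cast_sub hst] at h3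
  rw [h1, div_mul_eq_mul_div, ← mul_div_assoc]
  exact (div_le_div_iff_of_pos_right ht0).2 (by linarith)

theorem exists_mul_sqrt_add_one_le {a η : ℝ} (ha : 0 ≤ a) (hη : 0 < η) :
    ∃ T : ℕ, 1 ≤ T ∧ ∀ t : ℕ, T ≤ t → a * (Real.sqrt t + 1) ≤ η * t := by
  obtain ⟨n, hn⟩ := exists_nat_ge ((2 * a / η) ^ 2)
  refine ⟨n + 1, by omega, fun t ht => ?_⟩
  have ht1 : (n : ℝ) + 1 ≤ t := by exact_mod_cast ht
  have h1 : 2 * a / η ≤ Real.sqrt t := Real.le_sqrt_of_sq_le (by linarith)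
  have h2 : 1 ≤ Real.sqrt t := Real.one_le_sqrt.2 (by linarith [Nat.cast_nonneg (α := ℝ) n])
  rw [div_le_iff₀ hη] at h1
  have h3 : Real.sqrt t * Real.sqrt t = t := Real.mul_self_sqrt (Nat.cast_nonneg t)
  nlinarith

/-- Once the sample means are accurate from sample size `n` on, the statistic `Z(t)` grows linearly
from a time of order `n ^ 2` on, at any rate below the optimal one. -/
theorem exists_le_glrStat {C : (Fin M → EuclideanSpace ℝ (Fin d)) → Fin M → Fin K}
    (hC : IsSlinkMap C) {μ : Fin M → EuclideanSpace ℝ (Fin d)} (hμ : Separated μ (C μ)) {c c₁ : ℝ}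
    (hc : c < c₁)
    (hsup : ENNReal.ofReal c₁ < ⨆ w ∈ stdSimplex ℝ (Fin M), psi C w μ) :
    ∃ ξ > 0, ∃ T R : ℕ, ∀ {Ω : Type*} [MeasurableSpace Ω]
      (X : Fin M → ℕ → Ω → EuclideanSpace ℝ (Fin d)) (A : ℕ → Ω → Fin M)
      (w : ℕ → Ω → Fin M → ℝ), IsATBOCRun C X A w → ∀ (ω : Ω) (n : ℕ), 1 ≤ n →
      (∀ k, n ≤ k → ∀ m, ‖(k : ℝ)⁻¹ • ∑ i ∈ Finset.range k, X m i ω - μ m‖ ≤ ξ) →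
      ∀ t : ℕ, T + R * (n ^ 2 + n) ≤ t → ENNReal.ofReal (t * c) ≤ glrStat C X A t ω := by
  -- The rates `c < c₄ < c₃ < c₂ < c₁` budget four losses, from the top: plug-in weights, the
  -- initial `s` rounds, tracking error, and replacing `μ` by the empirical means.
  obtain ⟨c₂, h2, h2'⟩ := exists_between hc
  obtain ⟨c₃, h3, h3'⟩ := exists_between h2
  obtain ⟨c₄, h4, h4'⟩ := exists_between h3
  obtain ⟨ξ₁, hξ₁, hopt⟩ := exists_evidenceGE_of_optimalWeights hC hμ h2' hsup
  obtain ⟨η, hη, hweights⟩ := EvidenceGE.exists_weights_perturb (Alt C μ) μ h4'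
  obtain ⟨ξ₂, hξ₂, hcentre⟩ := EvidenceGE.exists_perturb (M := M) (d := d) h4
  -- With this `r`, `t ≥ (r + 1) * s` makes the initial `s` rounds cost at most `c₂ - c₃`.
  obtain ⟨r, hr⟩ : ∃ r : ℕ, c₂ / (c₂ - c₃) ≤ r := exists_nat_ge _
  obtain ⟨T, hT1, hT⟩ := exists_mul_sqrt_add_one_le (Nat.cast_nonneg M) hη
  refine ⟨min ξ₁ ξ₂, lt_min hξ₁ hξ₂, T, (r + 1) * M, fun {Ω} _ X A w hrun ω n hn hgood t ht => ?_⟩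
  have hM : 0 < M := (A 0 ω).pos
  -- From time `s` on, every arm has at least `n` samples by `le_pulls`.
  set s := M * n ^ 2 + M * n with hs
  have hts : T + (r + 1) * s ≤ t := by
    refine le_trans (le_of_eq ?_) ht
    rw [hs]
    ring
  have hst : s ≤ t := by nlinarith
  have ht0 : 0 < t := by omega
  have ht0' : (0 : ℝ) < t := by exact_mod_cast ht0
  have hclose : ∀ i, s ≤ i → ∀ m, ‖empMean X A i ω m - μ m‖ ≤ min ξ₁ ξ₂ := fun i hi m =>
    hgood _ (hrun.le_pulls ω hn hi m) m
  have hw : ∀ i, 1 ≤ i → ∀ m, 0 ≤ w i ω m := fun i hi => (hrun.weights_mem hi ω).1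
  have hsum := evidenceGE_cumWeight hw hst ht0 fun i hi =>
    (hopt (empMean X A i ω) fun m => (hclose i hi.le m).trans (min_le_left _ _)).2 _
      (hrun.weights i (by omega) ω)
  have hfrac : c₃ ≤ ((t : ℝ) - s) / t * c₂ := by
    rw [div_le_iff₀ (by linarith)] at hr
    have h5 : ((r : ℝ) + 1) * s ≤ t := by exact_mod_cast (Nat.le_add_left _ _).trans hts
    have hs0 : (0 : ℝ) ≤ s := Nat.cast_nonneg s
    have h6 : (s : ℝ) * c₂ ≤ t * (c₂ - c₃) := by
      have h7 := mul_le_mul_of_nonneg_left hr hs0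
      have h8 := mul_le_mul_of_nonneg_right h5 (show 0 ≤ c₂ - c₃ by linarith)
      have h9 : 0 ≤ (s : ℝ) * (c₂ - c₃) := mul_nonneg hs0 (by linarith)
      nlinarith
    rw [div_mul_eq_mul_div, le_div_iff₀ ht0']
    linarith
  have hN0 : ∀ m, 0 ≤ (pulls A t ω m : ℝ) / t := fun m => by positivity
  have hNsum : ∑ m, (pulls A t ω m : ℝ) / t = 1 := by
    rw [← Finset.sum_div, ← Nat.cast_sum, sum_pulls, div_self ht0'.ne']
  have hE : EvidenceGE (Alt C μ) (fun m => (pulls A t ω m : ℝ) / t) μ c₄ := by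
    refine hweights (fun m => cumWeight w t ω m / t)
      ⟨fun m => div_nonneg (hrun.cumWeight_nonneg t ω m) ht0'.le, ?_⟩ _ hN0 (fun m => ?_)
      fun ν hν => hfrac.trans (hsum ν hν)
    · rw [← Finset.sum_div, hrun.sum_cumWeight, div_self ht0'.ne']
    · have h5 := hrun.cumWeight_le_pulls_add ω t m
      have h6 := hT t (by omega)
      rw [div_sub' ht0'.ne']
      exact (div_le_div_iff_of_pos_right ht0').2 (by linarith)
  have hE' := hcentre _ _ ⟨hN0, hNsum⟩ μ (empMean X A t ω) (fun m => by
    rw [norm_sub_rev]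
    exact (hclose t hst m).trans (min_le_right _ _)) hE
  rw [← (hopt (empMean X A t ω) fun m => (hclose t hst m).trans (min_le_left _ _)).1] at hE'
  rw [glrStat, ENNReal.ofReal_mul ht0'.le, ENNReal.ofReal_natCast]
  exact mul_le_mul_right ((le_psi_iff hN0).2 hE') _

/-- Once the sample means are accurate from sample size `n` on, the algorithm stops after a time of
order `n ^ 2` plus the optimal time for the confidence level. -/
theorem exists_stopTime_le {C : (Fin M → EuclideanSpace ℝ (Fin d)) → Fin M → Fin K}
    (hC : IsSlinkMap C) {μ : Fin M → EuclideanSpace ℝ (Fin d)} (hμ : Separated μ (C μ)) {c c₁ : ℝ}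
    (hc0 : 0 < c) (hc : c < c₁)
    (hsup : ENNReal.ofReal c₁ < ⨆ w ∈ stdSimplex ℝ (Fin M), psi C w μ) :
    ∃ ξ > 0, ∃ T R : ℕ, ∀ {Ω : Type*} [MeasurableSpace Ω]
      (X : Fin M → ℕ → Ω → EuclideanSpace ℝ (Fin d)) (A : ℕ → Ω → Fin M)
      (w : ℕ → Ω → Fin M → ℝ), IsATBOCRun C X A w → ∀ (ω : Ω) (n : ℕ), 1 ≤ n →
      (∀ k, n ≤ k → ∀ m, ‖(k : ℝ)⁻¹ • ∑ i ∈ Finset.range k, X m i ω - μ m‖ ≤ ξ) →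
      ∀ δ ∈ Set.Ioo (0 : ℝ) 1, stopTime C X A δ ω ≤
        T + R * (n ^ 2 + n : ℕ) + ENNReal.ofReal (2 * Real.log (1 / δ) / c) := by
  -- The statistic grows at rate `c'`: the part `c * t` pays for `2 log(1/δ)`, the surplus `(c' - c)
  -- * t` for the logarithm of `t`.
  obtain ⟨c', h1, h2⟩ := exists_between hc
  obtain ⟨ξ, hξ, T, R, h⟩ := exists_le_glrStat hC hμ h2 hsup
  obtain ⟨T', hT1', hT'⟩ := exists_mul_sqrt_add_one_le (a := M * d * 2) (by positivity)
    (sub_pos.2 h1)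
  refine ⟨ξ, hξ, T + T' + 1, R, fun {Ω} _ X A w hrun ω n hn hgood δ hδ => ?_⟩
  have hL : 0 ≤ 2 * Real.log (1 / δ) / c := by
    have : 0 ≤ Real.log (1 / δ) := Real.log_nonneg (one_le_one_div hδ.1 hδ.2.le)
    positivity
  set q := ⌈2 * Real.log (1 / δ) / c⌉₊ with hq
  set t := T + T' + R * (n ^ 2 + n) + q with ht
  have hτ : stopTime C X A δ ω ≤ t := by
    refine iInf₂_le t ⟨by omega, ?_⟩
    refine (ENNReal.ofReal_le_ofReal ?_).trans (h X A w hrun ω n hn hgood t (by omega))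
    have h3 : 2 * Real.log (1 / δ) ≤ t * c := by
      rw [← div_le_iff₀ hc0]
      exact (Nat.le_ceil _).trans (by exact_mod_cast (by omega : q ≤ t))
    have h4 : Real.log (t + 1) ≤ 2 * (Real.sqrt t + 1) := by
      have h5 : Real.log (t + 1) = 2 * Real.log (Real.sqrt (t + 1)) := by
        rw [Real.log_sqrt (by positivity)]
        ring
      have h6 : Real.sqrt ((t : ℝ) + 1) ≤ Real.sqrt t + 1 := by
        refine Real.sqrt_le_iff.2 ⟨by positivity, ?_⟩
        nlinarith [Real.sq_sqrt (Nat.cast_nonneg (α := ℝ) t), Real.sqrt_nonneg (t : ℝ)]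
      have h7 := Real.log_le_self (Real.sqrt_nonneg ((t : ℝ) + 1))
      linarith
    have h8 := mul_le_mul_of_nonneg_left h4 (show (0 : ℝ) ≤ M * d by positivity)
    have h9 := hT' t (by omega)
    linarith [threshold_le (d := d) A hδ.1 t ω]
  have hq1 : (q : ℝ≥0∞) ≤ 1 + ENNReal.ofReal (2 * Real.log (1 / δ) / c) := by
    rw [← ENNReal.ofReal_natCast, ← ENNReal.ofReal_one, ← ENNReal.ofReal_add zero_le_one hL]
    exact ENNReal.ofReal_le_ofReal (by linarith [Nat.ceil_lt_add_one hL])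
  refine hτ.trans ?_
  calc (t : ℝ≥0∞) = T + T' + R * (n ^ 2 + n : ℕ) + q := by
        rw [ht]
        push_cast
        ring
    _ ≤ T + T' + R * (n ^ 2 + n : ℕ) + (1 + ENNReal.ofReal (2 * Real.log (1 / δ) / c)) := by
        gcongr
    _ = _ := by
        push_cast
        ring

end Deterministic
end BanditClustering

namespace BanditClustering

/-! ### Concentration of the sample means -/

section Concentration

variable {M d : ℕ} {Ω : Type*} [MeasurableSpace Ω] {P : Measure Ω}

theorem hasSubgaussianMGF_eval_sub {Y : Ω → EuclideanSpace ℝ (Fin d)}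
    {μ : EuclideanSpace ℝ (Fin d)} (hY : HasLaw Y (multivariateGaussian μ 1) P) (j : Fin d) :
    HasSubgaussianMGF (fun ω => Y ω j - μ j) 1 P := by
  have h1 : HasLaw (fun ω => Y ω j) (gaussianReal (μ j) 1) P := by
    have h := measurePreserving_eval_multivariateGaussian (μ := μ)
      (Matrix.PosSemidef.one (n := Fin d) (R := ℝ)) (i := j)
    simp only [Matrix.one_apply_eq, Real.toNNReal_one] at h
    exact h.hasLaw.comp hY
  have h2 : HasLaw (fun ω => Y ω j - μ j) (gaussianReal 0 1) P := by
    simpa using gaussianReal_sub_const h1 (μ j)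
  refine ⟨fun t => ?_, fun t => (mgf_gaussianReal h2.map_eq t).le.trans (by simp)⟩
  have h3 := integrable_exp_mul_gaussianReal (μ := 0) (v := 1) t
  rw [← h2.map_eq] at h3
  exact h3.comp_aemeasurable h2.aemeasurable

/-- A large norm forces a coordinate of size at least `ξ / (d + 1)`, and the bound sums `2 * d`
one-sided sub-Gaussian tails. Dividing by `d + 1` also covers `d = 0`. -/
theorem measure_norm_mean_sub_gt_le [IsProbabilityMeasure P]
    {Y : ℕ → Ω → EuclideanSpace ℝ (Fin d)} {μ : EuclideanSpace ℝ (Fin d)}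
    (hlaw : ∀ i, HasLaw (Y i) (multivariateGaussian μ 1) P) (hindep : iIndepFun Y P) {ξ : ℝ}
    (hξ : 0 < ξ) {k : ℕ} (hk : 1 ≤ k) :
    P {ω | ξ < ‖(k : ℝ)⁻¹ • ∑ i ∈ Finset.range k, Y i ω - μ‖} ≤
      ENNReal.ofReal (2 * d * Real.exp (-(ξ / (d + 1)) ^ 2 / 2 * k)) := by
  set r := ξ / (d + 1) with hr
  have hr0 : 0 < r := by positivity
  have hk0 : (0 : ℝ) < k := by exact_mod_cast hk
  let U : Fin d → Set Ω := fun j => {ω | k * r ≤ ∑ i ∈ Finset.range k, (Y i ω j - μ j)}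
  let V : Fin d → Set Ω := fun j => {ω | k * r ≤ ∑ i ∈ Finset.range k, -(Y i ω j - μ j)}
  have hexp : Real.exp (-(k * r) ^ 2 / (2 * k * (1 : NNReal))) = Real.exp (-r ^ 2 / 2 * k) := by
    congr 1
    push_cast
    field_simp
  have hind : ∀ j, iIndepFun (fun i ω => Y i ω j - μ j) P := fun j =>
    hindep.comp (fun _ y => y j - μ j) fun _ => by fun_prop
  have hU : ∀ j, P (U j) ≤ ENNReal.ofReal (Real.exp (-r ^ 2 / 2 * k)) := fun j => by
    rw [← ofReal_measureReal, ← hexp]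
    exact ENNReal.ofReal_le_ofReal (HasSubgaussianMGF.measure_sum_range_ge_le_of_iIndepFun (hind j)
      (fun i _ => hasSubgaussianMGF_eval_sub (hlaw i) j) (by positivity))
  have hV : ∀ j, P (V j) ≤ ENNReal.ofReal (Real.exp (-r ^ 2 / 2 * k)) := fun j => by
    rw [← ofReal_measureReal, ← hexp]
    exact ENNReal.ofReal_le_ofReal (HasSubgaussianMGF.measure_sum_range_ge_le_of_iIndepFun
      ((hind j).comp (fun _ y => -y) fun _ => measurable_neg)
      (fun i _ => (hasSubgaussianMGF_eval_sub (hlaw i) j).neg) (by positivity))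
  have hsub : {ω | ξ < ‖(k : ℝ)⁻¹ • ∑ i ∈ Finset.range k, Y i ω - μ‖} ⊆ ⋃ j, (U j ∪ V j) := by
    intro ω hω
    by_contra hcon
    simp only [Set.mem_iUnion, Set.mem_union, not_exists, not_or, U, V, Set.mem_ofPred_eq,
      not_le, Finset.sum_neg_distrib] at hcon
    refine absurd hω (not_lt.2 (abs_le_of_sq_le_sq' ?_ hξ.le).2)
    rw [EuclideanSpace.real_norm_sq_eq]
    have hj : ∀ j, ((k : ℝ)⁻¹ • ∑ i ∈ Finset.range k, Y i ω - μ).ofLp j ^ 2 ≤ r ^ 2 := by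
      intro j
      have h1 : ((k : ℝ)⁻¹ • ∑ i ∈ Finset.range k, Y i ω - μ).ofLp j =
          (∑ i ∈ Finset.range k, (Y i ω j - μ j)) / k := by
        simp only [PiLp.sub_apply, PiLp.smul_apply, smul_eq_mul, WithLp.ofLp_sum,
          Finset.sum_apply, Finset.sum_sub_distrib, Finset.sum_const, Finset.card_range,
          nsmul_eq_mul]
        field_simp
      rw [h1, sq_le_sq, abs_of_pos hr0, abs_le]
      obtain ⟨h2, h3⟩ := hcon j
      exact ⟨(le_div_iff₀ hk0).2 (by linarith), (div_le_iff₀ hk0).2 (by linarith)⟩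
    refine (Finset.sum_le_card_nsmul _ _ _ fun j _ => hj j).trans ?_
    have h4 : ξ = r * (d + 1) := by
      rw [hr]
      field_simp
    rw [nsmul_eq_mul, Finset.card_univ, Fintype.card_fin, h4]
    have hd : (0 : ℝ) ≤ d := Nat.cast_nonneg d
    nlinarith [mul_nonneg hd (sq_nonneg r), mul_nonneg (mul_nonneg hd hd) (sq_nonneg r),
      sq_nonneg r]
  refine (measure_mono hsub).trans ((measure_iUnion_fintype_le P _).trans ?_)
  refine (Finset.sum_le_card_nsmul _ _ (2 * ENNReal.ofReal (Real.exp (-r ^ 2 / 2 * k)))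
    fun j _ => ?_).trans ?_
  · rw [two_mul]
    exact (measure_union_le _ _).trans (add_le_add (hU j) (hV j))
  · rw [mul_comm (2 : ℝ), mul_assoc, ENNReal.ofReal_mul (Nat.cast_nonneg d),
      ENNReal.ofReal_mul zero_le_two, ENNReal.ofReal_natCast]
    simp

/-- An integrable random variable controls the largest sample size at which a sample mean is
inaccurate. -/
theorem exists_lintegral_lt_top [IsProbabilityMeasure P]
    {X : Fin M → ℕ → Ω → EuclideanSpace ℝ (Fin d)} {μ : Fin M → EuclideanSpace ℝ (Fin d)}
    (hlaw : ∀ m i, HasLaw (X m i) (multivariateGaussian (μ m) 1) P)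
    (hindep : iIndepFun (fun p : Fin M × ℕ => X p.1 p.2) P) {ξ : ℝ} (hξ : 0 < ξ) :
    ∃ S : Ω → ℝ≥0∞, Measurable S ∧ ∫⁻ ω, S ω ∂P < ∞ ∧ ∀ ω, ∀ k : ℕ, 1 ≤ k →
      (∃ m, ξ < ‖(k : ℝ)⁻¹ • ∑ i ∈ Finset.range k, X m i ω - μ m‖) → (k : ℝ≥0∞) ^ 2 ≤ S ω := by
  let E : ℕ → Set Ω := fun k =>
    ⋃ m, {ω | ξ < ‖(k : ℝ)⁻¹ • ∑ i ∈ Finset.range k, X m i ω - μ m‖}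
  -- The variable sought is `∑ f k`, with mean `∑ k² P(E k)`, finite by exponential decay.
  -- Measurable hulls are used because the samples are only a.e. measurable.
  let f : ℕ → Ω → ℝ≥0∞ := fun k =>
    (toMeasurable P (E k)).indicator fun _ => (k : ℝ≥0∞) ^ 2
  have hf : ∀ k, Measurable (f k) := fun k =>
    measurable_const.indicator (measurableSet_toMeasurable _ _)
  set a : ℝ := (ξ / (d + 1)) ^ 2 / 2 with ha
  have ha0 : 0 < a := by positivity
  have hE : ∀ k, 1 ≤ k → P (E k) ≤ ENNReal.ofReal (M * (2 * d * Real.exp (-a * k))) := by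
    intro k hk
    refine (measure_iUnion_fintype_le P _).trans ?_
    refine (Finset.sum_le_card_nsmul _ _ (ENNReal.ofReal (2 * d * Real.exp (-a * k)))
      fun m _ => ?_).trans ?_
    · have h := measure_norm_mean_sub_gt_le (hlaw m)
        (hindep.precomp (g := fun i : ℕ => (m, i)) fun i j hij => (Prod.mk.inj hij).2) hξ hk
      rwa [neg_div, ← ha] at h
    · rw [ENNReal.ofReal_mul (Nat.cast_nonneg M), ENNReal.ofReal_natCast]
      simp
  refine ⟨fun ω => ∑' k, f k ω, Measurable.tsum hf, ?_, fun ω k hk hω => ?_⟩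
  · rw [lintegral_tsum fun k => (hf k).aemeasurable]
    have hsum : Summable fun k : ℕ => M * (2 * d) * ((k : ℝ) ^ 2 * Real.exp (-a * k)) := by
      refine Summable.mul_left _ ?_
      simpa [mul_comm] using Real.summable_pow_mul_exp_neg_nat_mul 2 ha0
    refine (ENNReal.tsum_le_tsum fun k => ?_).trans_lt hsum.tsum_ofReal_lt_top
    rw [lintegral_indicator_const (measurableSet_toMeasurable _ _), measure_toMeasurable]
    rcases Nat.eq_zero_or_pos k with rfl | hk
    · simp
    · refine (mul_le_mul_right (hE k hk) _).trans (le_of_eq ?_)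
      rw [← ENNReal.ofReal_natCast k, ← ENNReal.ofReal_pow (Nat.cast_nonneg k),
        ← ENNReal.ofReal_mul (by positivity)]
      congr 1
      ring
  · refine le_trans ?_ (ENNReal.le_tsum k)
    have : ω ∈ toMeasurable P (E k) := subset_toMeasurable _ _ (Set.mem_iUnion.2 hω)
    simp [f, this]

end Concentration

end BanditClustering

namespace BanditClustering

/-! ### The sample complexity -/

/-- If only finitely many sample sizes are bad, with the squares of the bad ones at most `s`, then
all sample sizes from `n` on are good, for some `n` with `n ^ 2 + n` of order `s`. -/
theorem exists_forall_ge_not {p : ℕ → Prop} {s : ℝ≥0∞} (hs : s ≠ ∞)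
    (h : ∀ k : ℕ, 1 ≤ k → p k → (k : ℝ≥0∞) ^ 2 ≤ s) :
    ∃ n : ℕ, 1 ≤ n ∧ (∀ k, n ≤ k → ¬ p k) ∧ ((n ^ 2 + n : ℕ) : ℝ≥0∞) ≤ 2 + 6 * s := by
  classical
  have hex : ∃ n : ℕ, 1 ≤ n ∧ ∀ k, n ≤ k → ¬ p k := by
    obtain ⟨n, hn⟩ := ENNReal.exists_nat_gt hs
    refine ⟨n + 1, by omega, fun k hk hpk => ?_⟩
    have h1 := (h k (by omega) hpk).trans_lt hn
    have h2 : k ^ 2 < n := by exact_mod_cast h1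
    nlinarith
  obtain ⟨hn1, hn⟩ := Nat.find_spec hex
  refine ⟨Nat.find hex, hn1, hn, ?_⟩
  -- Either the least valid `n` is 1, giving the constant 2, or `q = n - 1` is bad, and `(q + 1)² +
  -- (q + 1) ≤ 6 q²` for `q ≥ 1`.
  rcases hn1.eq_or_lt with h1 | h1
  · rw [← h1]
    exact le_add_right (by norm_num)
  · obtain ⟨q, hq⟩ : ∃ q, Nat.find hex = q + 1 := ⟨Nat.find hex - 1, by omega⟩
    have hpq : p q := by
      by_contra hpq
      refine Nat.find_min hex (m := q) (by omega) ⟨by omega, fun k hk => ?_⟩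
      rcases hk.eq_or_lt with rfl | hk
      · exact hpq
      · exact hn k (by omega)
    have h2 := h q (by omega) hpq
    have h3 : (q + 1) ^ 2 + (q + 1) ≤ 6 * q ^ 2 := by
      have : 1 ≤ q := by omega
      nlinarith
    rw [hq]
    calc (((q + 1) ^ 2 + (q + 1) : ℕ) : ℝ≥0∞) ≤ ((6 * q ^ 2 : ℕ) : ℝ≥0∞) := by exact_mod_cast h3
      _ = 6 * (q : ℝ≥0∞) ^ 2 := by push_cast; rfl
      _ ≤ 6 * s := by gcongr
      _ ≤ _ := le_add_self

/-- The expected stopping time exceeds `2 log (1 / δ) / c` at most by a constant, for any rate `c`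
below the optimal one. -/
theorem exists_lintegral_stopTime_le {M K d : ℕ}
    {C : (Fin M → EuclideanSpace ℝ (Fin d)) → Fin M → Fin K} (hC : IsSlinkMap C)
    {μ : Fin M → EuclideanSpace ℝ (Fin d)} (hμ : Separated μ (C μ))
    {Ω : Type*} [MeasurableSpace Ω] {P : Measure Ω} [IsProbabilityMeasure P]
    {X : Fin M → ℕ → Ω → EuclideanSpace ℝ (Fin d)}
    (hlaw : ∀ m i, HasLaw (X m i) (multivariateGaussian (μ m) 1) P)
    (hindep : iIndepFun (fun p : Fin M × ℕ => X p.1 p.2) P)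
    {c : ℝ} (hc0 : 0 < c)
    (hsup : ENNReal.ofReal c < ⨆ w ∈ stdSimplex ℝ (Fin M), psi C w μ) :
    ∃ B : ℝ≥0∞, B ≠ ∞ ∧ ∀ δ ∈ Set.Ioo (0 : ℝ) 1, ∀ (A : ℕ → Ω → Fin M) (w : ℕ → Ω → Fin M → ℝ),
      IsATBOCRun C X A w →
        ∫⁻ ω, stopTime C X A δ ω ∂P ≤ B + ENNReal.ofReal (2 * Real.log (1 / δ) / c) := by
  obtain ⟨c₁, hc, hsup₁⟩ : ∃ c₁ : ℝ, c < c₁ ∧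
      ENNReal.ofReal c₁ < ⨆ w ∈ stdSimplex ℝ (Fin M), psi C w μ := by
    obtain ⟨q, hq1, hq2⟩ := ENNReal.lt_iff_exists_nnreal_btwn.1 hsup
    rw [← ENNReal.ofReal_coe_nnreal] at hq1 hq2
    exact ⟨q, (ENNReal.ofReal_lt_ofReal_iff_of_nonneg hc0.le).1 hq1, hq2⟩
  obtain ⟨ξ, hξ, T, R, hτ⟩ := exists_stopTime_le hC hμ hc0 hc hsup₁
  obtain ⟨S, hS, hSint, hSbad⟩ := exists_lintegral_lt_top hlaw hindep hξ
  have hR : ((R : ℝ≥0∞) + 1) ≠ ∞ := by simp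
  refine ⟨T + (R + 1) * (2 + 6 * ∫⁻ ω, S ω ∂P), ?_, fun δ hδ A w hrun => ?_⟩
  · exact ENNReal.add_ne_top.2 ⟨ENNReal.natCast_ne_top T, ENNReal.mul_ne_top hR
      (ENNReal.add_ne_top.2 ⟨by simp, ENNReal.mul_ne_top (by simp) hSint.ne⟩)⟩
  · set L := ENNReal.ofReal (2 * Real.log (1 / δ) / c)
    have hpt : ∀ ω, stopTime C X A δ ω ≤ T + (R + 1) * (2 + 6 * S ω) + L := by
      intro ω
      by_cases hω : S ω = ∞
      · simp [hω]
      · obtain ⟨n, hn1, hn, hns⟩ := exists_forall_ge_not hω (hSbad ω)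
        refine (hτ X A w hrun ω n hn1 (fun k hk m => ?_) δ hδ).trans ?_
        · exact not_lt.1 fun hlt => hn k hk ⟨m, hlt⟩
        · gcongr
          exact le_self_add
    -- Only the dominating function has to be measurable, not the stopping time.
    refine (lintegral_mono hpt).trans (le_of_eq ?_)
    rw [lintegral_add_right _ measurable_const, lintegral_add_left measurable_const,
      lintegral_const_mul _ (by fun_prop : Measurable fun ω => 2 + 6 * S ω),
      lintegral_add_left measurable_const, lintegral_const_mul _ hS]
    simp

theorem tendsto_log_one_div_nhdsGT_zero :
    Tendsto (fun δ : ℝ => ENNReal.ofReal (Real.log (1 / δ))) (𝓝[>] 0) (𝓝 ∞) := by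
  refine ENNReal.tendsto_ofReal_nhds_top.2 ?_
  simp only [one_div, Real.log_inv]
  exact tendsto_neg_atBot_atTop.comp Real.tendsto_log_nhdsGT_zero

end BanditClustering

open BanditClustering in
/-- The sample complexity of ATBOC is asymptotically at most twice the characteristic time. -/
theorem theorem4 {M K d : ℕ}
    -- the clustering map (single linkage into `K` clusters)
    (C : (Fin M → EuclideanSpace ℝ (Fin d)) → Fin M → Fin K)
    (hC : BanditClustering.IsSlinkMap C)
    -- the problem instance
    (μ : Fin M → EuclideanSpace ℝ (Fin d))
    (hμ : BanditClustering.Separated μ (C μ))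
    -- the samples of the arms
    {Ω : Type*} [MeasurableSpace Ω] (P : MeasureTheory.Measure Ω)
    [MeasureTheory.IsProbabilityMeasure P]
    (X : Fin M → ℕ → Ω → EuclideanSpace ℝ (Fin d))
    (hlaw : ∀ m i, ProbabilityTheory.HasLaw (X m i)
      (ProbabilityTheory.multivariateGaussian (μ m) 1) P)
    (hindep : ProbabilityTheory.iIndepFun (fun p : Fin M × ℕ => X p.1 p.2) P)
    -- for each confidence level `δ`, a run of the algorithm
    (A : ℝ → ℕ → Ω → Fin M) (w : ℝ → ℕ → Ω → Fin M → ℝ)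
    (hrun : ∀ δ ∈ Set.Ioo (0 : ℝ) 1, BanditClustering.IsATBOCRun C X (A δ) (w δ)) :
    Filter.limsup
      (fun δ : ℝ => (∫⁻ ω, BanditClustering.stopTime C X (A δ) δ ω ∂P) /
        ENNReal.ofReal (Real.log (1 / δ)))
      (nhdsWithin 0 (Set.Ioi 0)) ≤ 2 * BanditClustering.charTime C μ := by
  refine le_of_not_gt fun hlt => ?_
  set s := ⨆ w ∈ stdSimplex ℝ (Fin M), psi C w μ with hs
  have hs' : charTime C μ = s⁻¹ := rfl
  rw [hs', mul_comm, ← ENNReal.lt_div_iff_mul_lt (by simp) (by simp)] at hlt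
  -- A violation leaves room for a positive finite rate `c < s` with `2 / c` still below the limsup.
  -- The cases `s = 0` and `s = ∞` need no separate treatment.
  obtain ⟨c, hc1, hc2⟩ := ENNReal.lt_iff_exists_nnreal_btwn.1 (ENNReal.inv_lt_iff_inv_lt.1 hlt)
  have hc0 : (0 : ℝ) < c := by
    have : (0 : ℝ≥0∞) < c := pos_of_gt hc1
    exact_mod_cast this
  obtain ⟨B, hB, hint⟩ := exists_lintegral_stopTime_le hC hμ hlaw hindep hc0
    (by rwa [ENNReal.ofReal_coe_nnreal])
  refine absurd (ENNReal.inv_lt_iff_inv_lt.1 hc1) (not_lt.2 (ENNReal.div_le_of_le_mul' ?_))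
  have hlim : Tendsto (fun δ : ℝ => B / ENNReal.ofReal (Real.log (1 / δ)) + 2 * (c : ℝ≥0∞)⁻¹)
      (𝓝[>] 0) (𝓝 (2 * (c : ℝ≥0∞)⁻¹)) := by
    have h := ENNReal.Tendsto.const_div (a := B) tendsto_log_one_div_nhdsGT_zero (Or.inr hB)
    rw [ENNReal.div_top] at h
    simpa using h.add_const (2 * (c : ℝ≥0∞)⁻¹)
  rw [← hlim.limsup_eq]
  refine limsup_le_limsup ?_
  filter_upwards [Ioo_mem_nhdsGT (zero_lt_one' ℝ)] with δ hδ
  have hL : 0 < Real.log (1 / δ) := Real.log_pos (one_lt_one_div hδ.1 hδ.2)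
  have hL0 : ENNReal.ofReal (Real.log (1 / δ)) ≠ 0 := by simpa using hL
  refine (ENNReal.div_le_div_right (hint δ hδ _ _ (hrun δ hδ)) _).trans (le_of_eq ?_)
  rw [ENNReal.add_div, ENNReal.ofReal_div_of_pos hc0, ENNReal.ofReal_mul zero_le_two,
    ENNReal.ofReal_coe_nnreal, ENNReal.ofReal_ofNat]
  congr 1
  rw [div_eq_mul_inv, div_eq_mul_inv, mul_right_comm, mul_assoc 2,
    ENNReal.mul_inv_cancel hL0 ENNReal.ofReal_ne_top, mul_one]
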